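/- Let $n\in\mathbb{N}$, $\Omega=(0,1)^n$ and $h=(h_1,\dots,h_n)$ with all $h_j>0$. Let $L_h$ be the operator on $L^2(\Omega)$ acting as the Laplacian $\Delta=\sum_{j=1}^n\partial^2/\partial x_j^2$ with domain $$D(L_h)=\{f\in L^2(\Omega):\ \Delta f\in L^2(\Omega),\ f \text{ satisfies (BC)}\},$$ where (BC) are the boundary conditions $$h_j f|_{x_j=0}=f|_{x_j=1},\qquad h_j\,\partial_{x_j} f|_{x_j=0}=\partial_{x_j} f|_{x_j=1},\qquad j=1,\dots,n.$$ Here $\Delta f$ is taken in the sense of distributions, and (BC) in the weak sense: $\int_\Omega f\,\Delta\psi\,dx=\int_\Omega(\Delta f)\,\psi\,dx$ for all $\psi$ smooth on $\overline\Omega$ satisfying the conjugate conditions $\psi|_{x_j=0}=h_j\psi|_{x_j=1}$, $\partial_{x_j}\psi|_{x_j=0}=h_j\partial_{x_j}\psi|_{x_j=1}$, $j=1,\dots,n$. Let $C^\infty_{L_h}(\overline\Omega)=\bigcap_{k\ge 1}\mathrm{Dom}(L_h^k)$, with the Fréchet topology of the norms $\varphi\mapsto\max_{j\le k}\|L_h^j\varphi\|_{L^2(\Omega)}$,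 $k=0,1,2,\dots$. For $\xi\in\mathbb{Z}^n$ let $$u_\xi(x)=h_1^{x_1}\cdots h_n^{x_n}\,e^{2\pi i\,\xi\cdot x},$$ an eigenfunction of $L_h$ in $C^\infty_{L_h}(\overline\Omega)$ without zeros, and for a continuous linear operator $A:C^\infty_{L_h}(\overline\Omega)\to C^\infty_{L_h}(\overline\Omega)$ let $$\sigma_A(x,\xi)=u_\xi(x)^{-1}(Au_\xi)(x)$$ be its $L_h$-symbol. There is a constant $C_h>0$, depending only on $h$, such that the following holds for every $0<r\le 1$ and every continuous linear operator $A:C^\infty_{L_h}(\overline\Omega)\to C^\infty_{L_h}(\overline\Omega)$. If $$\sum_{\xi\in\mathbb{Z}^n}\|\sigma_A(\cdot,\xi)\|_{L^2(\Omega)}^r<\infty,$$ then $A$ extends to a bounded operator on $L^2(\Omega)$ belonging to the Schatten class $S_r(L^2(\Omega))$ (i.e. it is compact and its singular values $s_1\ge s_2\ge\dots$ satisfy $\sum_j s_j^r<\infty$), and this extension, again denoted by $A$, satisfies $$\|A\|_{S_r}^r=\sum_j s_j^r\ \le\ C_h^r\sum_{\xi\in\mathbb{Z}^n}\|\sigma_A(\cdot,\xi)\|_{L^2(\Omega)}^r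 .$$ -/

import Mathlib

open MeasureTheory Set
open scoped ENNReal ContDiff

noncomputable section

namespace LhModel

/-! ### The cube, the Laplacian and the boundary conditions -/

/-- The open unit cube `Ω = (0,1)^n`. -/
def cube (n : ℕ) : Set (Fin n → ℝ) := Set.pi Set.univ fun _ => Set.Ioo 0 1

/-- The Hilbert space `L²(Ω)` of complex-valued functions, for Lebesgue measure on `Ω`. -/
abbrev L2 (n : ℕ) : Type := Lp ℂ 2 (volume.restrict (cube n))

/-- The classical partial derivative `∂F/∂x_j`. -/
def partialD {n : ℕ} (j : Fin n) (F : (Fin n → ℝ) → ℂ) (x : Fin n → ℝ) : ℂ :=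
  fderiv ℝ F x (Pi.single j 1)

/-- The classical Laplacian `∑_j ∂²F/∂x_j²`. -/
def lap {n : ℕ} (F : (Fin n → ℝ) → ℂ) (x : Fin n → ℝ) : ℂ :=
  ∑ j, partialD j (partialD j F) x

/-- The boundary conditions (BC) in classical form, on the closed cube: for every `j`,
`h_j F|_{x_j=0} = F|_{x_j=1}` and `h_j ∂_jF|_{x_j=0} = ∂_jF|_{x_j=1}`. -/
def ClassicalBC {n : ℕ} (h : Fin n → ℝ) (F : (Fin n → ℝ) → ℂ) : Prop :=
  ∀ j, ∀ x ∈ Set.Icc (0 : Fin n → ℝ) 1,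
    (h j : ℂ) * F (Function.update x j 0) = F (Function.update x j 1) ∧
    (h j : ℂ) * partialD j F (Function.update x j 0) = partialD j F (Function.update x j 1)

/-- The conjugate boundary conditions (BC)*: for every `j`,
`F|_{x_j=0} = h_j F|_{x_j=1}` and `∂_jF|_{x_j=0} = h_j ∂_jF|_{x_j=1}`. -/
def ClassicalConjBC {n : ℕ} (h : Fin n → ℝ) (F : (Fin n → ℝ) → ℂ) : Prop :=
  ∀ j, ∀ x ∈ Set.Icc (0 : Fin n → ℝ) 1,
    F (Function.update x j 0) = (h j : ℂ) * F (Function.update x j 1) ∧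
    partialD j F (Function.update x j 0) = (h j : ℂ) * partialD j F (Function.update x j 1)

/-- `Δf = g` in `Ω` in the sense of distributions. -/
def HasWeakLaplacian {n : ℕ} (f g : L2 n) : Prop :=
  ∀ φ : (Fin n → ℝ) → ℂ, ContDiff ℝ ∞ φ → HasCompactSupport φ → tsupport φ ⊆ cube n →
    ∫ x in cube n, f x * lap φ x = ∫ x in cube n, g x * φ x

/-- The function `f ∈ L²(Ω)`, with `Δf = g ∈ L²(Ω)`, satisfies (BC) in the weak sense: Green's
formula holds without boundary terms against every function that is smooth on the closed cube and
satisfies the conjugate boundary conditions. For `f` smooth on the closed cube this follows from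
the classical form of (BC), see `green` below. -/
def SatisfiesBC {n : ℕ} (h : Fin n → ℝ) (f g : L2 n) : Prop :=
  ∀ ψ : (Fin n → ℝ) → ℂ, ContDiff ℝ ∞ ψ → ClassicalConjBC h ψ →
    ∫ x in cube n, f x * lap ψ x = ∫ x in cube n, g x * ψ x

/-! ### The operator `L_h` -/

lemma measurableSet_cube (n : ℕ) : MeasurableSet (cube n) :=
  MeasurableSet.univ_pi fun _ => measurableSet_Ioo

lemma isOpen_cube (n : ℕ) : IsOpen (cube n) :=
  isOpen_set_pi Set.finite_univ fun _ _ => isOpen_Ioo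

lemma cube_subset_Icc (n : ℕ) : cube n ⊆ Set.Icc (0 : Fin n → ℝ) 1 := fun _ hx =>
  ⟨fun i => (hx i (Set.mem_univ i)).1.le, fun i => (hx i (Set.mem_univ i)).2.le⟩

lemma cube_ae_eq_Icc (n : ℕ) :
    cube n =ᵐ[(volume : Measure (Fin n → ℝ))] Set.Icc (0 : Fin n → ℝ) 1 :=
  Measure.univ_pi_Ioo_ae_eq_Icc (μ := fun _ : Fin n => (volume : Measure ℝ))

instance instIsFiniteMeasureCube (n : ℕ) :
    IsFiniteMeasure ((volume : Measure (Fin n → ℝ)).restrict (cube n)) := by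
  refine ⟨?_⟩
  rw [Measure.restrict_apply_univ]
  exact (measure_mono (cube_subset_Icc n)).trans_lt isCompact_Icc.measure_lt_top

lemma memLp_of_continuous {n : ℕ} {F : (Fin n → ℝ) → ℂ} (hF : Continuous F) (p : ℝ≥0∞) :
    MemLp F p (volume.restrict (cube n)) := by
  obtain ⟨C, hC⟩ := (isCompact_Icc (a := (0 : Fin n → ℝ)) (b := 1)).exists_bound_of_continuousOn
    hF.continuousOn
  refine MemLp.of_bound hF.aestronglyMeasurable C ?_
  filter_upwards [ae_restrict_mem (measurableSet_cube n)] with x hx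
  exact hC x (cube_subset_Icc n hx)

lemma integrable_mul {n : ℕ} (f : L2 n) {F : (Fin n → ℝ) → ℂ} (hF : Continuous F) :
    Integrable (fun x => f x * F x) (volume.restrict (cube n)) :=
  (Lp.memLp f).integrable_mul (memLp_of_continuous hF 2)

lemma contDiff_partialD {n : ℕ} (j : Fin n) {F : (Fin n → ℝ) → ℂ} (hF : ContDiff ℝ ∞ F) :
    ContDiff ℝ ∞ (partialD j F) :=
  (hF.fderiv_right (m := ∞) (by simp)).clm_apply contDiff_const

lemma continuous_lap {n : ℕ} {F : (Fin n → ℝ) → ℂ} (hF : ContDiff ℝ ∞ F) :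
    Continuous (lap F) :=
  continuous_finsetSum _ fun j _ =>
    (contDiff_partialD j (contDiff_partialD j hF)).continuous

/-- The graph of `L_h`: the pairs `(f, Δf)` with `f ∈ L²(Ω)`, `Δf ∈ L²(Ω)` and `f` satisfying
(BC). -/
def graphLh {n : ℕ} (h : Fin n → ℝ) : Submodule ℂ (L2 n × L2 n) where
  carrier := {p | HasWeakLaplacian p.1 p.2 ∧ SatisfiesBC h p.1 p.2}
  zero_mem' := by
    have h0 : ∀ ψ : (Fin n → ℝ) → ℂ, ∫ x in cube n, ((0 : L2 n) : (Fin n → ℝ) → ℂ) x * ψ x = 0 := by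
      intro ψ
      refine integral_eq_zero_of_ae ?_
      filter_upwards [Lp.coeFn_zero ℂ 2 (volume.restrict (cube n))] with x hx
      rw [hx, Pi.zero_apply, zero_mul]
    exact ⟨fun φ _ _ _ => (h0 _).trans (h0 _).symm, fun ψ _ _ => (h0 _).trans (h0 _).symm⟩
  add_mem' := by
    have hadd : ∀ (f g : L2 n) (ψ : (Fin n → ℝ) → ℂ), Continuous ψ →
        ∫ x in cube n, (f + g : L2 n) x * ψ x
          = (∫ x in cube n, f x * ψ x) + ∫ x in cube n, g x * ψ x := by
      intro f g ψ hψ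
      rw [← integral_add (integrable_mul f hψ) (integrable_mul g hψ)]
      refine integral_congr_ae ?_
      filter_upwards [Lp.coeFn_add f g] with x hx
      rw [hx, Pi.add_apply, add_mul]
    rintro ⟨f, f'⟩ ⟨g, g'⟩ ⟨h1, h2⟩ ⟨h3, h4⟩
    refine ⟨fun φ ha hb hc => ?_, fun ψ ha hb => ?_⟩
    · exact (hadd f g _ (continuous_lap ha)).trans
        ((congrArg₂ (· + ·) (h1 φ ha hb hc) (h3 φ ha hb hc)).trans
          (hadd f' g' _ ha.continuous).symm)
    · exact (hadd f g _ (continuous_lap ha)).trans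
        ((congrArg₂ (· + ·) (h2 ψ ha hb) (h4 ψ ha hb)).trans
          (hadd f' g' _ ha.continuous).symm)
  smul_mem' := by
    have hsmul : ∀ (c : ℂ) (f : L2 n) (ψ : (Fin n → ℝ) → ℂ),
        ∫ x in cube n, (c • f : L2 n) x * ψ x = c * ∫ x in cube n, f x * ψ x := by
      intro c f ψ
      rw [← integral_const_mul]
      refine integral_congr_ae ?_
      filter_upwards [Lp.coeFn_smul c f] with x hx
      rw [hx, Pi.smul_apply, smul_eq_mul, mul_assoc]
    rintro c ⟨f, f'⟩ ⟨h1, h2⟩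
    refine ⟨fun φ ha hb hc => ?_, fun ψ ha hb => ?_⟩
    · exact (hsmul c f _).trans
        ((congrArg (c * ·) (h1 φ ha hb hc)).trans (hsmul c f' _).symm)
    · exact (hsmul c f _).trans
        ((congrArg (c * ·) (h2 ψ ha hb)).trans (hsmul c f' _).symm)

/-- The weak Laplacian is unique, so that `graphLh h` is the graph of an operator. -/
lemma graphLh_functional {n : ℕ} (h : Fin n → ℝ) :
    ∀ p : L2 n × L2 n, p ∈ graphLh h → p.1 = 0 → p.2 = 0 := by
  rintro ⟨f, g⟩ ⟨h1, -⟩ (rfl : f = 0)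
  have hg : Integrable (g : (Fin n → ℝ) → ℂ) (volume.restrict (cube n)) :=
    (Lp.memLp g).integrable (by norm_num)
  have key := (isOpen_cube n).ae_eq_zero_of_integral_contDiff_smul_eq_zero
    (f := (g : (Fin n → ℝ) → ℂ)) (μ := volume.restrict (cube n))
    (hg.locallyIntegrable.locallyIntegrableOn _) (fun φ hφ hc hs => by
      have hcs : HasCompactSupport fun x => (φ x : ℂ) := hc.comp_left (g := ((↑) : ℝ → ℂ)) rfl
      have hts : tsupport (fun x => (φ x : ℂ)) ⊆ cube n :=
        (closure_mono (Function.support_comp_subset (g := ((↑) : ℝ → ℂ)) rfl φ)).trans hs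
      have := h1 (fun x => (φ x : ℂ)) (Complex.ofRealCLM.contDiff.comp hφ) hcs hts
      have h0 : ∫ x in cube n, ((0 : L2 n) : (Fin n → ℝ) → ℂ) x
          * lap (fun x => (φ x : ℂ)) x = 0 := by
        refine integral_eq_zero_of_ae ?_
        filter_upwards [Lp.coeFn_zero ℂ 2 (volume.restrict (cube n))] with x hx
        rw [hx, Pi.zero_apply, zero_mul]
      rw [← h0, this]
      refine integral_congr_ae (Filter.Eventually.of_forall fun x => ?_)
      simp [mul_comm])
  refine (Lp.eq_zero_iff_ae_eq_zero).2 ?_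
  filter_upwards [key, ae_restrict_mem (measurableSet_cube n)] with x hx hm using hx hm

/-- The operator `L_h = Δ` on `L²(Ω)` with domain
`{f ∈ L²(Ω) : Δf ∈ L²(Ω), f satisfies (BC)}`. -/
def Lh {n : ℕ} (h : Fin n → ℝ) : L2 n →ₗ.[ℂ] L2 n := (graphLh h).toLinearPMap

lemma mem_graph_Lh {n : ℕ} (h : Fin n → ℝ) (p : L2 n × L2 n) :
    p ∈ (Lh h).graph ↔ HasWeakLaplacian p.1 p.2 ∧ SatisfiesBC h p.1 p.2 := by
  rw [Lh, Submodule.toLinearPMap_graph_eq _ (graphLh_functional h)]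
  rfl

/-! ### The space of test functions `C^∞_{L_h}` -/

/-- The domain of the power `L_h^k`. -/
def domPow {n : ℕ} (h : Fin n → ℝ) : ℕ → Submodule ℂ (L2 n)
  | 0 => ⊤
  | k + 1 => ((domPow h k).comap (Lh h).toFun).map (Lh h).domain.subtype

lemma mem_domPow_succ {n : ℕ} (h : Fin n → ℝ) (k : ℕ) (f : L2 n) :
    f ∈ domPow h (k + 1) ↔ ∃ hf : f ∈ (Lh h).domain, Lh h ⟨f, hf⟩ ∈ domPow h k := by
  simp only [domPow, Submodule.mem_map, Submodule.mem_comap]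
  constructor
  · rintro ⟨g, hg, rfl⟩
    exact ⟨g.2, hg⟩
  · rintro ⟨hf, hg⟩
    exact ⟨⟨f, hf⟩, hg, rfl⟩

/-- `Dom(L_h^∞) = ⋂_k Dom(L_h^k)`, as a subspace of `L²(Ω)`. -/
def testSubmodule {n : ℕ} (h : Fin n → ℝ) : Submodule ℂ (L2 n) := ⨅ k, domPow h k

/-- The space `C^∞_{L_h}` of test functions, i.e. `Dom(L_h^∞)`. It is a type of its own because its
topology (below) is not that of `L²(Ω)`. -/
def TestSpace {n : ℕ} (h : Fin n → ℝ) : Type := testSubmodule h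

instance instAddCommGroupTestSpace {n : ℕ} (h : Fin n → ℝ) : AddCommGroup (TestSpace h) :=
  inferInstanceAs (AddCommGroup (testSubmodule h))

instance instModuleTestSpace {n : ℕ} (h : Fin n → ℝ) : Module ℂ (TestSpace h) :=
  inferInstanceAs (Module ℂ (testSubmodule h))

/-- The inclusion of `C^∞_{L_h}` into `L²(Ω)`. -/
def toL2 {n : ℕ} (h : Fin n → ℝ) : TestSpace h →ₗ[ℂ] L2 n := (testSubmodule h).subtype

lemma toL2_mem_domain {n : ℕ} (h : Fin n → ℝ) (f : TestSpace h) :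
    toL2 h f ∈ (Lh h).domain :=
  ((mem_domPow_succ h 0 _).1 ((Submodule.mem_iInf _).1 f.2 1)).1

lemma Lh_toL2_mem {n : ℕ} (h : Fin n → ℝ) (f : TestSpace h) :
    Lh h ⟨toL2 h f, toL2_mem_domain h f⟩ ∈ testSubmodule h :=
  (Submodule.mem_iInf _).2 fun k =>
    ((mem_domPow_succ h k _).1 ((Submodule.mem_iInf _).1 f.2 (k + 1))).2

/-- The operator `L_h` on `C^∞_{L_h}`. -/
def LhTest {n : ℕ} (h : Fin n → ℝ) : Module.End ℂ (TestSpace h) where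
  toFun f := (⟨Lh h ⟨toL2 h f, toL2_mem_domain h f⟩, Lh_toL2_mem h f⟩ : testSubmodule h)
  map_add' f g := Subtype.ext ((Lh h).map_add ⟨toL2 h f, toL2_mem_domain h f⟩
    ⟨toL2 h g, toL2_mem_domain h g⟩)
  map_smul' c f := Subtype.ext ((Lh h).map_smul c ⟨toL2 h f, toL2_mem_domain h f⟩)

/-- The Fréchet topology of `C^∞_{L_h}`, given by the norms `φ ↦ max_{j ≤ k} ‖L_h^j φ‖_{L²}`,
`k = 0, 1, 2, …`: the coarsest topology for which all the maps `φ ↦ L_h^j φ ∈ L²(Ω)` are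
continuous. -/
instance instTopologicalSpaceTestSpace {n : ℕ} (h : Fin n → ℝ) :
    TopologicalSpace (TestSpace h) :=
  TopologicalSpace.induced (fun (φ : TestSpace h) (j : ℕ) => toL2 h ((LhTest h ^ j) φ))
    Pi.topologicalSpace

/-! ### The eigenfunctions `u_ξ` -/

/-- `u_ξ(x) = h^x exp(2πi ξ·x)` where `h^x = ∏_j h_j^{x_j}`. -/
def uFun {n : ℕ} (h : Fin n → ℝ) (ξ : Fin n → ℤ) (x : Fin n → ℝ) : ℂ :=
  ((∏ j, h j ^ x j : ℝ) : ℂ) * Complex.exp (2 * Real.pi * Complex.I * ∑ j, (ξ j : ℂ) * (x j : ℂ))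

lemma hasFDerivAt_of_contDiff {n : ℕ} {F : (Fin n → ℝ) → ℂ} (hF : ContDiff ℝ ∞ F)
    (x : Fin n → ℝ) : HasFDerivAt F (fderiv ℝ F x) x :=
  (hF.differentiable (by simp) x).hasFDerivAt

/-- Green's formula on the cube: the boundary terms cancel for a function satisfying (BC) and one
satisfying the conjugate conditions. -/
lemma green {n : ℕ} {h : Fin n → ℝ} {F G : (Fin n → ℝ) → ℂ} (hF : ContDiff ℝ ∞ F)
    (hG : ContDiff ℝ ∞ G) (bF : ClassicalBC h F) (bG : ClassicalConjBC h G) :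
    ∫ x in cube n, F x * lap G x = ∫ x in cube n, lap F x * G x := by
  cases n with
  | zero => simp [lap]
  | succ m =>
    have hF' := fun j => contDiff_partialD j hF
    have hG' := fun j => contDiff_partialD j hG
    let V : Fin (m + 1) → (Fin (m + 1) → ℝ) → ℂ := fun j x =>
      F x * partialD j G x - partialD j F x * G x
    let V' : Fin (m + 1) → (Fin (m + 1) → ℝ) → (Fin (m + 1) → ℝ) →L[ℝ] ℂ := fun j x =>
      (F x • fderiv ℝ (partialD j G) x + partialD j G x • fderiv ℝ F x) -
        (partialD j F x • fderiv ℝ G x + G x • fderiv ℝ (partialD j F) x)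
    have hV : ∀ j x, HasFDerivAt (V j) (V' j x) x := fun j x =>
      ((hasFDerivAt_of_contDiff hF x).mul (hasFDerivAt_of_contDiff (hG' j) x)).sub
        ((hasFDerivAt_of_contDiff (hF' j) x).mul (hasFDerivAt_of_contDiff hG x))
    have hdiv : ∀ x, ∑ j, V' j x (Pi.single j 1) = F x * lap G x - lap F x * G x := by
      intro x
      simp only [V', lap, Finset.mul_sum, Finset.sum_mul, ← Finset.sum_sub_distrib]
      refine Finset.sum_congr rfl fun j _ => ?_
      simp only [partialD, sub_apply, add_apply, smul_apply, smul_eq_mul]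
      ring
    have hcont : Continuous fun x => F x * lap G x - lap F x * G x :=
      (hF.continuous.mul (continuous_lap hG)).sub ((continuous_lap hF).mul hG.continuous)
    have hdt := integral_divergence_of_hasFDerivAt_off_countable' (a := (0 : Fin (m + 1) → ℝ))
      (b := 1) zero_le_one V V' ∅ Set.countable_empty
      (fun j => ((hF.continuous.mul (hG' j).continuous).sub
        ((hF' j).continuous.mul hG.continuous)).continuousOn)
      (fun x _ j => hV j x)
      (by
        simp only [hdiv]
        exact hcont.continuousOn.integrableOn_compact isCompact_Icc)
    simp only [hdiv] at hdt
    have hbd : ∀ (j : Fin (m + 1)), ∀ y ∈ Set.Icc (0 : Fin m → ℝ) 1,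
        V j (j.insertNth (1 : ℝ) y) = V j (j.insertNth (0 : ℝ) y) := by
      intro j y hy
      have hx : (j.insertNth (0 : ℝ) y : Fin (m + 1) → ℝ) ∈ Set.Icc (0 : Fin (m + 1) → ℝ) 1 := by
        constructor
        · exact Fin.le_insertNth_iff.2 ⟨le_rfl, fun i => hy.1 i⟩
        · exact Fin.insertNth_le_iff.2 ⟨zero_le_one, fun i => hy.2 i⟩
      have e1 := bF j _ hx
      have e2 := bG j _ hx
      simp only [Fin.update_insertNth] at e1 e2
      simp only [V]
      rw [← e1.1, ← e1.2, e2.1, e2.2]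
      ring
    have h0 : ∫ x in Set.Icc (0 : Fin (m + 1) → ℝ) 1, (F x * lap G x - lap F x * G x) = 0 := by
      rw [hdt]
      refine Finset.sum_eq_zero fun j _ => ?_
      rw [sub_eq_zero]
      exact setIntegral_congr_fun measurableSet_Icc fun y hy => hbd j y hy
    rw [← setIntegral_congr_set (cube_ae_eq_Icc (m + 1)), integral_sub] at h0
    · exact sub_eq_zero.1 h0
    · exact (memLp_of_continuous (hF.continuous.mul (continuous_lap hG)) 1).integrable le_rfl
    · exact (memLp_of_continuous ((continuous_lap hF).mul hG.continuous) 1).integrable le_rfl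

/-- The class in `L²(Ω)` of a continuous function. -/
def ofContinuous {n : ℕ} (F : (Fin n → ℝ) → ℂ) (hF : Continuous F) : L2 n :=
  (memLp_of_continuous hF 2).toLp F

lemma integral_ofContinuous {n : ℕ} (F : (Fin n → ℝ) → ℂ) (hF : Continuous F)
    (G : (Fin n → ℝ) → ℂ) :
    ∫ x in cube n, ofContinuous F hF x * G x = ∫ x in cube n, F x * G x := by
  refine integral_congr_ae ?_
  filter_upwards [(memLp_of_continuous hF 2).coeFn_toLp] with x hx
  rw [ofContinuous, hx]

lemma conjBC_of_tsupport {n : ℕ} (h : Fin n → ℝ) {φ : (Fin n → ℝ) → ℂ}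
    (hs : tsupport φ ⊆ cube n) : ClassicalConjBC h φ := by
  have h0 : ∀ x, x ∉ cube n → φ x = 0 ∧ ∀ j, partialD j φ x = 0 := by
    intro x hx
    have hx' : x ∉ tsupport φ := fun hm => hx (hs hm)
    refine ⟨image_eq_zero_of_notMem_tsupport hx', fun j => ?_⟩
    have : fderiv ℝ φ x = 0 := by
      by_contra hne
      exact hx' (support_fderiv_subset ℝ hne)
    simp [partialD, this]
  intro j x _
  have a0 : Function.update x j 0 ∉ cube n := fun hm => by
    have := hm j (Set.mem_univ j); simp at this
  have a1 : Function.update x j 1 ∉ cube n := fun hm => by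
    have := hm j (Set.mem_univ j); simp at this
  simp [(h0 _ a0).1, (h0 _ a1).1, (h0 _ a0).2 j, (h0 _ a1).2 j]

/-- Functions that are smooth on the closed cube and satisfy (BC) classically are in the domain of
`L_h`, and `L_h` acts on them as the classical Laplacian. -/
lemma smooth_mem_graph {n : ℕ} {h : Fin n → ℝ} {F : (Fin n → ℝ) → ℂ} (hF : ContDiff ℝ ∞ F)
    (bF : ClassicalBC h F) :
    (ofContinuous F hF.continuous, ofContinuous (lap F) (continuous_lap hF)) ∈ (Lh h).graph := by
  rw [mem_graph_Lh]
  have key : SatisfiesBC h (ofContinuous F hF.continuous)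
      (ofContinuous (lap F) (continuous_lap hF)) := by
    intro ψ hψ bψ
    rw [integral_ofContinuous, integral_ofContinuous]
    exact green hF hψ bF bψ
  exact ⟨fun φ hφ _ hs => key φ hφ (conjBC_of_tsupport h hs), key⟩

/-- The exponent in `u_ξ = exp(∑_j μ_j x_j)`, namely `μ_j = log h_j + 2πi ξ_j`. -/
def uExp {n : ℕ} (h : Fin n → ℝ) (ξ : Fin n → ℤ) (j : Fin n) : ℂ :=
  Real.log (h j) + 2 * Real.pi * Complex.I * ξ j

lemma uFun_eq {n : ℕ} {h : Fin n → ℝ} (hh : ∀ j, 0 < h j) (ξ : Fin n → ℤ) :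
    uFun h ξ = fun x => Complex.exp (∑ j, uExp h ξ j * (x j : ℂ)) := by
  funext x
  have : ((∏ j, h j ^ x j : ℝ) : ℂ) = Complex.exp (∑ j, (Real.log (h j) : ℂ) * (x j : ℂ)) := by
    rw [Complex.exp_sum, Complex.ofReal_prod]
    refine Finset.prod_congr rfl fun j _ => ?_
    rw [Real.rpow_def_of_pos (hh j)]
    push_cast
    rfl
  rw [uFun, this, ← Complex.exp_add, Finset.mul_sum, ← Finset.sum_add_distrib]
  congr 1
  refine Finset.sum_congr rfl fun j _ => ?_
  rw [uExp]
  ring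

lemma uFun_ne_zero {n : ℕ} {h : Fin n → ℝ} (hh : ∀ j, 0 < h j) (ξ : Fin n → ℤ)
    (x : Fin n → ℝ) : uFun h ξ x ≠ 0 := by
  rw [uFun_eq hh]
  exact Complex.exp_ne_zero _

lemma contDiff_uFun {n : ℕ} {h : Fin n → ℝ} (hh : ∀ j, 0 < h j) (ξ : Fin n → ℤ) :
    ContDiff ℝ ∞ (uFun h ξ) := by
  rw [uFun_eq hh]
  refine ContDiff.cexp (ContDiff.sum fun j _ => contDiff_const.mul ?_)
  exact Complex.ofRealCLM.contDiff.comp (contDiff_apply ℝ ℝ j)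

lemma partialD_uFun {n : ℕ} {h : Fin n → ℝ} (hh : ∀ j, 0 < h j) (ξ : Fin n → ℤ) (j : Fin n) :
    partialD j (uFun h ξ) = fun x => uExp h ξ j * uFun h ξ x := by
  funext x
  have hlin : HasFDerivAt (fun x : Fin n → ℝ => ∑ i, uExp h ξ i * (x i : ℂ))
      (∑ i, uExp h ξ i • (Complex.ofRealCLM.comp
        (ContinuousLinearMap.proj (R := ℝ) (φ := fun _ : Fin n => ℝ) i))) x := by
    refine HasFDerivAt.fun_sum fun i _ => ?_
    exact ((Complex.ofRealCLM.comp (ContinuousLinearMap.proj (R := ℝ)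
      (φ := fun _ : Fin n => ℝ) i)).hasFDerivAt).const_mul (uExp h ξ i)
  rw [uFun_eq hh, partialD, hlin.cexp.fderiv]
  have hs : (∑ i, uExp h ξ i • (Complex.ofRealCLM.comp
      (ContinuousLinearMap.proj (R := ℝ) (φ := fun _ : Fin n => ℝ) i))) (Pi.single j 1)
      = uExp h ξ j := by
    rw [sum_apply, Finset.sum_eq_single j]
    · simp
    · intro i _ hi
      simp [hi]
    · simp
  rw [smul_apply, hs, smul_eq_mul, mul_comm]

lemma lap_uFun {n : ℕ} {h : Fin n → ℝ} (hh : ∀ j, 0 < h j) (ξ : Fin n → ℤ) :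
    lap (uFun h ξ) = fun x => (∑ j, uExp h ξ j ^ 2) * uFun h ξ x := by
  funext x
  rw [lap, Finset.sum_mul]
  refine Finset.sum_congr rfl fun j _ => ?_
  have hd : DifferentiableAt ℝ (uFun h ξ) x := (contDiff_uFun hh ξ).differentiable (by simp) x
  have : partialD j (partialD j (uFun h ξ)) x = uExp h ξ j * partialD j (uFun h ξ) x := by
    conv_lhs => rw [partialD_uFun hh]
    rw [partialD, (hd.hasFDerivAt.const_mul (uExp h ξ j)).fderiv]
    simp [partialD]
  rw [this, partialD_uFun hh]
  ring

lemma uFun_update {n : ℕ} {h : Fin n → ℝ} (hh : ∀ j, 0 < h j) (ξ : Fin n → ℤ) (j : Fin n)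
    (x : Fin n → ℝ) :
    (h j : ℂ) * uFun h ξ (Function.update x j 0) = uFun h ξ (Function.update x j 1) := by
  have hexp : Complex.exp (uExp h ξ j) = h j := by
    rw [uExp, Complex.exp_add, ← Complex.ofReal_exp, Real.exp_log (hh j)]
    have : (2 * Real.pi * Complex.I * ξ j : ℂ) = ξ j * (2 * Real.pi * Complex.I) := by ring
    rw [this, Complex.exp_int_mul_two_pi_mul_I, mul_one]
  rw [uFun_eq hh]
  simp only
  rw [← hexp, ← Complex.exp_add]
  congr 1
  rw [← Finset.add_sum_erase _ _ (Finset.mem_univ j),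
    ← Finset.add_sum_erase (a := j) Finset.univ
      (fun i => uExp h ξ i * ((Function.update x j 1 i : ℝ) : ℂ)) (Finset.mem_univ j)]
  have : ∀ t : ℝ, ∑ i ∈ Finset.univ.erase j, uExp h ξ i * ((Function.update x j t i : ℝ) : ℂ)
      = ∑ i ∈ Finset.univ.erase j, uExp h ξ i * (x i : ℂ) := fun t =>
    Finset.sum_congr rfl fun i hi => by
      rw [Function.update_of_ne (Finset.ne_of_mem_erase hi)]
  rw [this, this]
  simp

lemma classicalBC_uFun {n : ℕ} {h : Fin n → ℝ} (hh : ∀ j, 0 < h j) (ξ : Fin n → ℤ) :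
    ClassicalBC h (uFun h ξ) := by
  intro j x _
  refine ⟨uFun_update hh ξ j x, ?_⟩
  rw [partialD_uFun hh]
  simp only
  rw [← uFun_update hh ξ j x]
  ring

/-- The class of `u_ξ` in `L²(Ω)`. -/
def uL2 {n : ℕ} (h : Fin n → ℝ) (hh : ∀ j, 0 < h j) (ξ : Fin n → ℤ) : L2 n :=
  ofContinuous (uFun h ξ) (contDiff_uFun hh ξ).continuous

/-- `u_ξ` is an eigenfunction of `L_h`. -/
lemma uL2_mem_graph {n : ℕ} {h : Fin n → ℝ} (hh : ∀ j, 0 < h j) (ξ : Fin n → ℤ) :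
    (uL2 h hh ξ, (∑ j, uExp h ξ j ^ 2) • uL2 h hh ξ) ∈ (Lh h).graph := by
  have key := smooth_mem_graph (contDiff_uFun hh ξ) (classicalBC_uFun hh ξ)
  have e : (∑ j, uExp h ξ j ^ 2) • uL2 h hh ξ
      = ofContinuous (lap (uFun h ξ)) (continuous_lap (contDiff_uFun hh ξ)) := by
    have hc := continuous_lap (contDiff_uFun hh ξ)
    have e1 : ofContinuous (lap (uFun h ξ)) hc = (MemLp.toLp _ ((memLp_of_continuous
        (contDiff_uFun hh ξ).continuous 2).const_smul (∑ j, uExp h ξ j ^ 2))) :=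
      MemLp.toLp_congr _ _ (Filter.Eventually.of_forall fun x => by
        rw [lap_uFun hh, Pi.smul_apply, smul_eq_mul])
    exact (e1.trans (MemLp.toLp_const_smul _
      (memLp_of_continuous (contDiff_uFun hh ξ).continuous 2))).symm
  rw [e]
  exact key

lemma uL2_mem {n : ℕ} {h : Fin n → ℝ} (hh : ∀ j, 0 < h j) (ξ : Fin n → ℤ) :
    uL2 h hh ξ ∈ testSubmodule h := by
  refine (Submodule.mem_iInf _).2 fun k => ?_
  induction k with
  | zero => exact Submodule.mem_top
  | succ k ih =>
    obtain ⟨y, hy1, hy2⟩ := LinearPMap.mem_graph_iff _ |>.1 (uL2_mem_graph hh ξ)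
    replace hy1 : (y : L2 n) = uL2 h hh ξ := hy1
    have hm : uL2 h hh ξ ∈ (Lh h).domain := hy1 ▸ y.2
    refine (mem_domPow_succ h k _).2 ⟨hm, ?_⟩
    have : (⟨uL2 h hh ξ, hm⟩ : (Lh h).domain) = y := Subtype.ext hy1.symm
    rw [this, hy2]
    exact Submodule.smul_mem _ _ ih

/-- `u_ξ` as an element of `C^∞_{L_h}`. -/
def uTest {n : ℕ} (h : Fin n → ℝ) (hh : ∀ j, 0 < h j) (ξ : Fin n → ℤ) : TestSpace h :=
  (⟨uL2 h hh ξ, uL2_mem hh ξ⟩ : testSubmodule h)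

/-! ### Symbols -/

/-- The `L_h`-symbol `σ_A(x, ξ) = u_ξ(x)⁻¹ (A u_ξ)(x)` of a continuous linear operator `A` on
`C^∞_{L_h}`. As `A u_ξ` is an element of `L²(Ω)`, this is, for each `ξ`, a function of `x`
determined up to a null set; the functions `u_ξ` have no zeros, see `uFun_ne_zero`. -/
def symbol {n : ℕ} (h : Fin n → ℝ) (hh : ∀ j, 0 < h j) (A : TestSpace h →L[ℂ] TestSpace h)
    (x : Fin n → ℝ) (ξ : Fin n → ℤ) : ℂ :=
  (uFun h ξ x)⁻¹ * (toL2 h (A (uTest h hh ξ)) : L2 n) x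

/-! ### Schatten classes -/

/-- The multiplicity of `s > 0` as a singular value of `T`, i.e. the multiplicity of `s²` as an
eigenvalue of `T*T` (equivalently, of `s` as an eigenvalue of `|T|`). -/
def singularMult {H : Type*} [NormedAddCommGroup H] [InnerProductSpace ℂ H] [CompleteSpace H]
    (T : H →L[ℂ] H) (s : ℝ) : ℕ∞ :=
  Cardinal.toENat (Module.rank ℂ (Module.End.eigenspace
    ((ContinuousLinearMap.adjoint T ∘L T : H →L[ℂ] H) : Module.End ℂ H) ((s : ℂ) ^ 2)))

/-- The Schatten quasi-norm `‖T‖_{S_r} = (∑_j s_j(T)^r)^{1/r}`, with values in `[0, ∞]`, where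
`s_j(T)` are the non-zero singular values of `T`, repeated according to multiplicity. -/
def schattenNorm {H : Type*} [NormedAddCommGroup H] [InnerProductSpace ℂ H] [CompleteSpace H]
    (r : ℝ) (T : H →L[ℂ] H) : ℝ≥0∞ :=
  (∑' s : {s : ℝ // 0 < s}, (singularMult T s : ℝ≥0∞) * ENNReal.ofReal (s : ℝ) ^ r) ^ (1 / r)

/-- The Schatten class `S_r(H)`: the compact operators whose singular values are `r`-summable. -/
def MemSchatten {H : Type*} [NormedAddCommGroup H] [InnerProductSpace ℂ H] [CompleteSpace H]
    (r : ℝ) (T : H →L[ℂ] H) : Prop :=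
  IsCompactOperator T ∧ schattenNorm r T < ⊤

end LhModel

end

open LhModel

/-! Let `M` be multiplication by h^{-x} and e_ξ(x) = exp(2πi ξ·x), a Hilbert basis of L²(Ω). Since
u_ξ = h^x e_ξ, every f is the sum of ⟨e_ξ, Mf⟩ u_ξ. These coefficients turn L_h into multiplication
by its eigenvalues, so for test functions the series converges in the Fréchet topology
(`hasSum_coeffU_test`), and continuity of A gives Af = ∑ ⟨e_ξ, Mf⟩ w_ξ with w_ξ = A u_ξ. Hence A
extends to T = S∘M, where S e_ξ = w_ξ. As |u_ξ| = h^x is bounded on Ω uniformly in ξ, ‖w_ξ‖ ≤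
K‖σ_A(·,ξ)‖. For r ≤ 1 the ‖w_ξ‖ are summable, so S is a norm limit of finite-rank operators.

The quantitative part is ‖T‖_{S_r}^r ≤ c^r ∑ ‖S e_ξ‖^r (`schattenNorm_rpow_le`). The factor M enters
only through T* = M*S*, which gives ‖T*x‖ ≤ c‖S*x‖. The powers are compared by concavity of t ↦
t^{r/2}, applied twice: with the unitary matrix that makes the images under S* of the left singular
vectors of T orthogonal (`sum_rpow_le_tsum`), and with the squared coordinates of these images in
the basis e (`sum_norm_rpow_le_tsum`). -/

noncomputable section

namespace LhModel

/-! ### Schatten quasi-norms and Hilbert bases -/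

/-- Jensen's inequality for `x ↦ x ^ p` with weights of total mass at most one. -/
lemma sum_mul_rpow_le_rpow {κ : Type*} (t : Finset κ) {V δ : κ → ℝ} {w p : ℝ}
    (hV : ∀ k ∈ t, 0 ≤ V k) (hV1 : ∑ k ∈ t, V k ≤ 1) (hδ : ∀ k ∈ t, 0 ≤ δ k)
    (hw : ∑ k ∈ t, V k * δ k ≤ w) (hp : 0 < p) (hp1 : p ≤ 1) :
    ∑ k ∈ t, V k * δ k ^ p ≤ w ^ p := by
  have hnn : 0 ≤ ∑ k ∈ t, V k * δ k := Finset.sum_nonneg fun k hk => mul_nonneg (hV k hk) (hδ k hk)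
  refine le_trans ?_ (Real.rpow_le_rpow hnn hw hp.le)
  -- Hölder with exponents 1/p and 1/(1-p), applied to V δ^p = (V δ)^p · V^{1-p}; at p = 1 the
  -- second exponent degenerates.
  rcases hp1.lt_or_eq with hp1 | rfl
  swap
  · simp
  have hq : (1 / p).HolderConjugate (1 / (1 - p)) := by
    have h1p : 0 < 1 - p := by linarith
    refine Real.holderConjugate_iff.2 ⟨?_, ?_⟩
    · rw [lt_div_iff₀ hp]; linarith
    · field_simp; ring
  have H := Real.inner_le_Lp_mul_Lq t (fun k => (V k * δ k) ^ p) (fun k => V k ^ (1 - p)) hq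
  have e1 : ∑ k ∈ t, (V k * δ k) ^ p * V k ^ (1 - p) = ∑ k ∈ t, V k * δ k ^ p := by
    refine Finset.sum_congr rfl fun k hk => ?_
    rw [Real.mul_rpow (hV k hk) (hδ k hk), mul_right_comm, ← Real.rpow_add_of_nonneg (hV k hk) hp.le
      (by linarith), add_sub_cancel, Real.rpow_one]
  have e2 : ∑ k ∈ t, |(V k * δ k) ^ p| ^ (1 / p) = ∑ k ∈ t, V k * δ k := by
    refine Finset.sum_congr rfl fun k hk => ?_
    have := mul_nonneg (hV k hk) (hδ k hk)
    rw [abs_of_nonneg (Real.rpow_nonneg this _), ← Real.rpow_mul this, mul_one_div_cancel hp.ne',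
      Real.rpow_one]
  have e3 : ∑ k ∈ t, |V k ^ (1 - p)| ^ (1 / (1 - p)) = ∑ k ∈ t, V k := by
    refine Finset.sum_congr rfl fun k hk => ?_
    rw [abs_of_nonneg (Real.rpow_nonneg (hV k hk) _), ← Real.rpow_mul (hV k hk),
      mul_one_div_cancel (by linarith), Real.rpow_one]
  rw [e1, e2, e3, one_div_one_div, one_div_one_div] at H
  refine H.trans (mul_le_of_le_one_right (Real.rpow_nonneg hnn _) ?_)
  exact Real.rpow_le_one (Finset.sum_nonneg hV) hV1 (by linarith)

section Abstract

variable {H : Type*} [NormedAddCommGroup H] [InnerProductSpace ℂ H] [CompleteSpace H]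

/-- A Gram matrix can be diagonalized by a unitary change of the vectors. -/
lemma exists_orthonormalBasis_inner_eq {κ : Type*} [Fintype κ] (v : κ → H) :
    ∃ (N : ℕ) (b : OrthonormalBasis (Fin N) ℂ (EuclideanSpace ℂ κ)), ∀ l m, l ≠ m →
      inner ℂ (∑ k, b l k • v k) (∑ k, b m k • v k) = 0 := by
  -- The Gram matrix is Y*Y. For its eigenvectors, ⟨Y b_l, Y b_m⟩ = ⟨b_l, Y*Y b_m⟩ is a multiple of
  -- ⟨b_l, b_m⟩.
  let Y : EuclideanSpace ℂ κ →L[ℂ] H :=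
    ∑ k, (EuclideanSpace.proj k : EuclideanSpace ℂ κ →L[ℂ] ℂ).smulRight (v k)
  have hY : ∀ x, Y x = ∑ k, x k • v k := fun x => by simp [Y]
  let R : EuclideanSpace ℂ κ →L[ℂ] EuclideanSpace ℂ κ := ContinuousLinearMap.adjoint Y ∘L Y
  have hR : (R : EuclideanSpace ℂ κ →ₗ[ℂ] EuclideanSpace ℂ κ).IsSymmetric := fun x y => by
    simp [R, ContinuousLinearMap.adjoint_inner_left, ContinuousLinearMap.adjoint_inner_right]
  refine ⟨_, hR.eigenvectorBasis rfl, fun l m hlm => ?_⟩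
  rw [← hY, ← hY, ← ContinuousLinearMap.adjoint_inner_right]
  have := hR.apply_eigenvectorBasis rfl m
  have h2 : ContinuousLinearMap.adjoint Y (Y (hR.eigenvectorBasis rfl m))
      = (hR.eigenvalues rfl m : ℂ) • hR.eigenvectorBasis rfl m := this
  rw [h2, inner_smul_right, (hR.eigenvectorBasis rfl).orthonormal.2 hlm, mul_zero]

/-- If `g` is orthonormal and diagonalizes `S S*`, then `∑ ‖S* g_l‖^{2p} ≤ ∑ ‖S e_i‖^{2p}` for every
Hilbert basis `e` and `0 < p ≤ 1`. -/
lemma sum_norm_rpow_le_tsum {ι κ : Type*} [Fintype κ] (e : HilbertBasis ι ℂ H) (S : H →L[ℂ] H)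
    {g : κ → H} (hg : Orthonormal ℂ g)
    (hS : ∀ l m, l ≠ m →
      inner ℂ (ContinuousLinearMap.adjoint S (g l)) (ContinuousLinearMap.adjoint S (g m)) = 0)
    (h0 : ∀ l, ContinuousLinearMap.adjoint S (g l) ≠ 0) {p : ℝ} (hp : 0 < p) (hp1 : p ≤ 1) :
    ENNReal.ofReal (∑ l, (‖ContinuousLinearMap.adjoint S (g l)‖ ^ 2) ^ p) ≤
      ∑' i, ENNReal.ofReal ((‖S (e i)‖ ^ 2) ^ p) := by
  set d : κ → H := fun l => ContinuousLinearMap.adjoint S (g l) with hd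
  set γ : κ → ℝ := fun l => ‖d l‖ ^ 2 with hγ
  have hγ0 : ∀ l, 0 < γ l := fun l => by have := norm_pos_iff.2 (h0 l); positivity
  -- Squared coordinates of the normalized d_l: by Parseval they sum to one over i, and by Bessel to
  -- at most one over l. This allows the sum over l to be compared with the sum over i term by term.
  let V : κ → ι → ℝ := fun l i => ‖inner ℂ (e i) (d l)‖ ^ 2 / γ l
  have hV0 : ∀ l i, 0 ≤ V l i := fun l i => by have := hγ0 l; positivity
  have hVs : ∀ l, HasSum (V l) 1 := fun l => by
    have := (Complex.hasSum_re (e.hasSum_inner_mul_inner (d l) (d l)))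
    have h2 : HasSum (fun i => ‖inner ℂ (e i) (d l)‖ ^ 2) (γ l) := by
      convert this using 2 with i
      · rw [← inner_conj_symm (d l) (e i), ← Complex.normSq_eq_conj_mul_self,
          Complex.normSq_eq_norm_sq, Complex.ofReal_re]
      · simp only [γ]
        rw [inner_self_eq_norm_sq_to_K]
        norm_cast
    simpa [V, div_self (hγ0 l).ne'] using h2.div_const (γ l)
  have hsum : ENNReal.ofReal (∑ l, γ l ^ p) = ∑' i, ENNReal.ofReal (∑ l, V l i * γ l ^ p) := by
    have h3 : HasSum (fun i => ∑ l, V l i * γ l ^ p) (∑ l, γ l ^ p) := by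
      refine hasSum_sum fun l _ => ?_
      simpa using (hVs l).mul_right (γ l ^ p)
    rw [← h3.tsum_eq, ENNReal.ofReal_tsum_of_nonneg _ h3.summable]
    exact fun i => Finset.sum_nonneg fun l _ => mul_nonneg (hV0 l i) (Real.rpow_nonneg (hγ0 l).le _)
  rw [hsum]
  refine ENNReal.tsum_le_tsum fun i => ENNReal.ofReal_le_ofReal ?_
  refine sum_mul_rpow_le_rpow _ (fun l _ => hV0 l i) ?_ (fun l _ => (hγ0 l).le) ?_ hp hp1
  -- Total mass at most one: Bessel for the unit vector e_i and the normalized d_l.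
  · have hon : Orthonormal ℂ fun l => ((‖d l‖⁻¹ : ℝ) : ℂ) • d l := by
      refine ⟨fun l => ?_, fun l m hlm => ?_⟩
      · rw [norm_smul, Complex.norm_real, norm_inv, norm_norm,
          inv_mul_cancel₀ (norm_ne_zero_iff.2 (h0 l))]
      · change inner ℂ (((‖d l‖⁻¹ : ℝ) : ℂ) • d l) (((‖d m‖⁻¹ : ℝ) : ℂ) • d m) = 0
        rw [inner_smul_left, inner_smul_right, hS l m hlm, mul_zero, mul_zero]
    have := hon.sum_inner_products_le (e i) (s := Finset.univ)
    rw [e.orthonormal.1 i, one_pow] at this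
    refine le_trans (le_of_eq (Finset.sum_congr rfl fun l _ => ?_)) this
    rw [inner_smul_left, norm_mul, ← norm_inner_symm (e i)]
    simp only [V, γ, Complex.conj_ofReal, Complex.norm_real, norm_inv, norm_norm]
    ring
  -- V γ = |⟨e_i, S* g_l⟩|² = |⟨S e_i, g_l⟩|², so Bessel for g bounds the weighted mean by ‖S e_i‖².
  · have := hg.sum_inner_products_le (S (e i)) (s := Finset.univ)
    refine le_trans (le_of_eq (Finset.sum_congr rfl fun l _ => ?_)) this
    rw [div_mul_cancel₀ _ (hγ0 l).ne', norm_inner_symm (e i), hd,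
      ContinuousLinearMap.adjoint_inner_left]

/-- If `T` has singular vectors `a`, `f` with singular values `s` and `‖T* x‖ ≤ c ‖S* x‖`, then
`∑ s_k^{2p} ≤ c^{2p} ∑ ‖S e_i‖^{2p}`. -/
lemma sum_rpow_le_tsum {ι κ : Type*} [Fintype κ] (e : HilbertBasis ι ℂ H) (S T : H →L[ℂ] H)
    {c : ℝ}
    (hST : ∀ x, ‖ContinuousLinearMap.adjoint T x‖ ≤ c * ‖ContinuousLinearMap.adjoint S x‖)
    {s : κ → ℝ} (hs : ∀ k, 0 < s k) {a f : κ → H} (ha : Orthonormal ℂ a) (hf : Orthonormal ℂ f)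
    (haf : ∀ k, ContinuousLinearMap.adjoint T (f k) = (s k : ℂ) • a k)
    {p : ℝ} (hp : 0 < p) (hp1 : p ≤ 1) :
    ENNReal.ofReal (∑ k, (s k ^ 2) ^ p) ≤
      ENNReal.ofReal ((c ^ 2) ^ p) * ∑' i, ENNReal.ofReal ((‖S (e i)‖ ^ 2) ^ p) := by
  obtain ⟨N, b, hb⟩ := exists_orthonormalBasis_inner_eq
    fun k => ContinuousLinearMap.adjoint S (f k)
  -- The f_k are rotated within their span so that the S* g_l become orthogonal. The price is that
  -- the T* g_l are no longer multiples of single a_k; the doubly stochastic matrix |b_{lk}|²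
  -- accounts for it.
  let g : Fin N → H := fun l => ∑ k, b l k • f k
  have hSg : ∀ l, ContinuousLinearMap.adjoint S (g l)
      = ∑ k, b l k • ContinuousLinearMap.adjoint S (f k) := fun l => by simp [g]
  have hg : Orthonormal ℂ g := by
    classical
    rw [orthonormal_iff_ite]
    intro l m
    rw [hf.inner_sum, ← orthonormal_iff_ite.1 b.orthonormal l m, PiLp.inner_apply]
    exact Finset.sum_congr rfl fun k _ => by rw [RCLike.inner_apply, mul_comm]
  have hTg : ∀ l, ‖ContinuousLinearMap.adjoint T (g l)‖ ^ 2 = ∑ k, ‖b l k‖ ^ 2 * s k ^ 2 := by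
    intro l
    have h1 : ContinuousLinearMap.adjoint T (g l) = ∑ k, (b l k * s k) • a k := by
      simp only [g, map_sum, map_smul, haf, smul_smul]
    have h2 := ha.inner_sum (fun k => b l k * s k) (fun k => b l k * s k) Finset.univ
    rw [← h1, inner_self_eq_norm_sq_to_K] at h2
    apply Complex.ofReal_injective
    push_cast
    refine h2.trans (Finset.sum_congr rfl fun k _ => ?_)
    rw [← Complex.normSq_eq_conj_mul_self, Complex.normSq_eq_norm_sq, norm_mul, Complex.norm_real,
      Real.norm_of_nonneg (hs k).le]
    push_cast
    ring
  have hcol : ∀ k, ∑ l, ‖b l k‖ ^ 2 = 1 := by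
    classical
    intro k
    have := b.sum_sq_norm_inner_left (EuclideanSpace.single k (1 : ℂ))
    simpa [EuclideanSpace.inner_single_left] using this
  have hrow : ∀ l, ∑ k, ‖b l k‖ ^ 2 = 1 := fun l => by
    rw [← EuclideanSpace.norm_sq_eq, b.orthonormal.1 l, one_pow]
  -- If S* g_l = 0 then T* g_l = 0; as all s_k > 0, the whole row b_l would vanish.
  have h0 : ∀ l, ContinuousLinearMap.adjoint S (g l) ≠ 0 := by
    intro l hl
    have h1 := hST (g l)
    rw [hl, norm_zero, mul_zero] at h1
    have h2 := hTg l
    rw [le_antisymm h1 (norm_nonneg _), zero_pow two_ne_zero] at h2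
    have h3 := (Finset.sum_eq_zero_iff_of_nonneg fun k _ => by positivity).1 h2.symm
    have h4 : ∑ k, ‖b l k‖ ^ 2 = 0 := Finset.sum_eq_zero fun k hk =>
      (mul_eq_zero.1 (h3 k hk)).resolve_right (pow_ne_zero _ (hs k).ne')
    rw [hrow] at h4
    exact one_ne_zero h4
  have key := sum_norm_rpow_le_tsum e S hg (fun l m hlm => by rw [hSg, hSg]; exact hb l m hlm)
    h0 hp hp1
  refine le_trans ?_ (mul_le_mul_right key _)
  rw [← ENNReal.ofReal_mul (by positivity), Finset.mul_sum]
  refine ENNReal.ofReal_le_ofReal ?_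
  calc ∑ k, (s k ^ 2) ^ p = ∑ k, ∑ l, ‖b l k‖ ^ 2 * (s k ^ 2) ^ p :=
        Finset.sum_congr rfl fun k _ => by rw [← Finset.sum_mul, hcol, one_mul]
    _ = ∑ l, ∑ k, ‖b l k‖ ^ 2 * (s k ^ 2) ^ p := Finset.sum_comm
    -- Jensen in row l: the mean of the s_k² is ‖T* g_l‖² ≤ c²‖S* g_l‖².
    _ ≤ _ := Finset.sum_le_sum fun l _ => by
        rw [← Real.mul_rpow (by positivity) (by positivity)]
        refine sum_mul_rpow_le_rpow _ (fun _ _ => by positivity) (hrow l).le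
          (fun _ _ => by positivity) ?_ hp hp1
        rw [← hTg, ← mul_pow]
        exact pow_le_pow_left₀ (norm_nonneg _) (hST _) 2

/-- A natural number below `toENat` of the dimension is realized by an orthonormal family. -/
lemma exists_orthonormal_of_le_rank {E : Type*} [NormedAddCommGroup E] [InnerProductSpace ℂ E]
    {N : ℕ} (hN : (N : ℕ∞) ≤ Cardinal.toENat (Module.rank ℂ E)) :
    ∃ v : Fin N → E, Orthonormal ℂ v := by
  have h1 : (N : Cardinal) ≤ Module.rank ℂ E := by
    simpa using hN
  obtain ⟨f, hf⟩ := Module.le_rank_iff_exists_linearMap.1 h1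
  have hli : LinearIndependent ℂ fun i => f (Pi.single i 1) :=
    (Pi.linearIndependent_single_one (Fin N) ℂ).map' f (LinearMap.ker_eq_bot.2 hf)
  exact ⟨_, InnerProductSpace.gramSchmidtNormed_orthonormal hli⟩

/-- Allowing any finite `N` below the multiplicities keeps all families finite before the
eigenspaces are known to be finite-dimensional. The exponent p = r/2 is what requires r ≤ 2. -/
lemma sum_mult_le_tsum {ι : Type*} (e : HilbertBasis ι ℂ H) (S T : H →L[ℂ] H)
    {c : ℝ} (hc : 0 ≤ c)
    (hST : ∀ x, ‖ContinuousLinearMap.adjoint T x‖ ≤ c * ‖ContinuousLinearMap.adjoint S x‖)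
    {r : ℝ} (hr : 0 < r) (hr2 : r ≤ 2) (F : Finset {s : ℝ // 0 < s}) (N : {s : ℝ // 0 < s} → ℕ)
    (hN : ∀ s, (N s : ℕ∞) ≤ singularMult T s) :
    ∑ s ∈ F, (N s : ℝ≥0∞) * ENNReal.ofReal (s : ℝ) ^ r ≤
      ENNReal.ofReal c ^ r * ∑' i, ‖S (e i)‖ₑ ^ r := by
  set R : H →L[ℂ] H := ContinuousLinearMap.adjoint T ∘L T with hRdef
  have hR : (R : H →ₗ[ℂ] H).IsSymmetric := fun x y => by
    simp [R, ContinuousLinearMap.adjoint_inner_left, ContinuousLinearMap.adjoint_inner_right]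
  choose v hv using fun s => exists_orthonormal_of_le_rank (hN s)
  have hfam : OrthogonalFamily ℂ
      (fun s : F => Module.End.eigenspace (R : Module.End ℂ H) ((s.1.1 : ℂ) ^ 2))
      (fun s => (Module.End.eigenspace (R : Module.End ℂ H) ((s.1.1 : ℂ) ^ 2)).subtypeₗᵢ) := by
    refine hR.orthogonalFamily_eigenspaces.comp (γ := F)
      (f := fun s => ((s.1.1 : ℂ) ^ 2)) fun s t hst => ?_
    have h1 : (s.1.1 : ℝ) ^ 2 = t.1.1 ^ 2 := by
      have h2 : (s.1.1 : ℂ) ^ 2 = (t.1.1 : ℂ) ^ 2 := hst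
      exact_mod_cast h2
    exact Subtype.ext (Subtype.ext
      ((pow_left_inj₀ s.1.2.le t.1.2.le two_ne_zero).1 h1))
  let κ := Σ s : F, Fin (N s)
  let σ : κ → ℝ := fun k => k.1.1.1
  have hσ : ∀ k, 0 < σ k := fun k => k.1.1.2
  let a : κ → H := fun k => v k.1.1 k.2
  have ha : Orthonormal ℂ a := hfam.orthonormal_sigma_orthonormal fun s => hv s.1
  have haR : ∀ k, ContinuousLinearMap.adjoint T (T (a k)) = ((σ k : ℂ) ^ 2) • a k := fun k =>
    Module.End.mem_eigenspace_iff.1 (v k.1.1 k.2).2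
  have hσ0 : ∀ k, (σ k : ℂ) ≠ 0 := fun k => by exact_mod_cast (hσ k).ne'
  -- The left singular vectors; they are orthonormal because T*T a_k = σ_k² a_k.
  let f : κ → H := fun k => ((σ k : ℂ)⁻¹) • T (a k)
  have haf : ∀ k, ContinuousLinearMap.adjoint T (f k) = (σ k : ℂ) • a k := fun k => by
    simp only [f, map_smul, haR, smul_smul]
    congr 1
    field_simp [hσ0 k]
  have hf : Orthonormal ℂ f := by
    classical
    rw [orthonormal_iff_ite] at ha ⊢
    intro k l
    simp only [f]
    rw [inner_smul_left, inner_smul_right, ← ContinuousLinearMap.adjoint_inner_right, haR,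
      inner_smul_right, ha]
    by_cases hkl : k = l
    · subst hkl
      simp only [if_true, map_inv₀, Complex.conj_ofReal]
      field_simp [hσ0 k]
    · simp [hkl]
  have key := sum_rpow_le_tsum e S T hST hσ ha hf haf (p := r / 2) (by positivity) (by linarith)
  have hpow : ∀ x : ℝ, 0 ≤ x → ENNReal.ofReal ((x ^ 2) ^ (r / 2)) = ENNReal.ofReal x ^ r := by
    intro x hx
    rw [← Real.rpow_natCast, ← Real.rpow_mul hx, ENNReal.ofReal_rpow_of_nonneg hx hr.le]
    congr 2
    push_cast
    ring
  rw [ENNReal.ofReal_sum_of_nonneg (fun k _ => by positivity), hpow c hc] at key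
  simp only [hpow _ (norm_nonneg _), hpow _ (hσ _).le, ofReal_norm] at key
  refine le_trans (le_of_eq ?_) key
  rw [Fintype.sum_sigma, ← Finset.sum_coe_sort F]
  refine Finset.sum_congr rfl fun s _ => ?_
  simp [σ]

/-- If `‖T* x‖ ≤ c ‖S* x‖`, then `‖T‖_{S_r}^r ≤ c^r ∑ ‖S e_i‖^r` for every Hilbert basis `e` and
`0 < r ≤ 2`. -/
lemma schattenNorm_rpow_le {ι : Type*} (e : HilbertBasis ι ℂ H) (S T : H →L[ℂ] H)
    {c : ℝ} (hc : 0 ≤ c)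
    (hST : ∀ x, ‖ContinuousLinearMap.adjoint T x‖ ≤ c * ‖ContinuousLinearMap.adjoint S x‖)
    {r : ℝ} (hr : 0 < r) (hr2 : r ≤ 2) (hfin : ∑' i, ‖S (e i)‖ₑ ^ r < ⊤) :
    schattenNorm r T ^ r ≤ ENNReal.ofReal c ^ r * ∑' i, ‖S (e i)‖ₑ ^ r := by
  have hb := sum_mult_le_tsum e S T hc hST hr hr2
  have hR : ENNReal.ofReal c ^ r * ∑' i, ‖S (e i)‖ₑ ^ r < ⊤ :=
    ENNReal.mul_lt_top (ENNReal.rpow_lt_top_of_nonneg hr.le ENNReal.ofReal_ne_top) hfin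
  -- An infinite multiplicity would let M s^r, with M arbitrarily large, stay below the finite
  -- bound.
  have hmult : ∀ s : {s : ℝ // 0 < s}, singularMult T s ≠ ⊤ := by
    intro s htop
    have hs : ENNReal.ofReal (s : ℝ) ^ r ≠ 0 := by
      have := ENNReal.ofReal_pos.2 s.2
      exact (ENNReal.rpow_pos this ENNReal.ofReal_ne_top).ne'
    have hs' : ENNReal.ofReal (s : ℝ) ^ r ≠ ⊤ :=
      ENNReal.rpow_ne_top_of_nonneg hr.le ENNReal.ofReal_ne_top
    obtain ⟨M, hM⟩ := ENNReal.exists_nat_mul_gt hs hR.ne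
    classical
    have := hb {s} (Pi.single s M) (fun t => by
      by_cases hts : t = s
      · subst hts; rw [htop]; exact le_top
      · simp [hts])
    simp only [Finset.sum_singleton, Pi.single_eq_same] at this
    exact absurd this (not_le.2 hM)
  rw [schattenNorm, ← ENNReal.rpow_mul, one_div_mul_cancel hr.ne', ENNReal.rpow_one,
    ENNReal.tsum_eq_iSup_sum]
  refine iSup_le fun F => ?_
  choose N hN using fun s => ENat.ne_top_iff_exists.1 (hmult s)
  refine le_trans (le_of_eq (Finset.sum_congr rfl fun s _ => ?_)) (hb F N fun s => (hN s).le)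
  rw [← hN s]
  rfl

end Abstract

/-! ### Multiplication operators -/

/-- Multiplication by a continuous function, as an operator on `L²(Ω)`. -/
def mulOp {n : ℕ} (F : (Fin n → ℝ) → ℂ) (hF : Continuous F) : L2 n →L[ℂ] L2 n :=
  (ContinuousLinearMap.mul ℂ ℂ).holderL (volume.restrict (cube n)) ∞ 2 2
    ((memLp_of_continuous hF ∞).toLp F)

lemma coeFn_mulOp {n : ℕ} {F : (Fin n → ℝ) → ℂ} (hF : Continuous F) (f : L2 n) :
    mulOp F hF f =ᵐ[volume.restrict (cube n)] fun x => F x * f x := by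
  have h1 := (ContinuousLinearMap.mul ℂ ℂ).coeFn_holder (r := 2)
    (f := (memLp_of_continuous hF ∞).toLp F) (g := f)
  filter_upwards [h1, (memLp_of_continuous hF ∞).coeFn_toLp] with x hx hx2
  rw [← hx2]
  exact hx

lemma mulOp_mulOp_of_mul_eq_one {n : ℕ} {F G : (Fin n → ℝ) → ℂ} (hF : Continuous F)
    (hG : Continuous G) (h : ∀ x, F x * G x = 1) (f : L2 n) : mulOp F hF (mulOp G hG f) = f := by
  refine Lp.ext ?_
  filter_upwards [coeFn_mulOp hF (mulOp G hG f), coeFn_mulOp hG f] with x h1 h2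
  rw [h1, h2, ← mul_assoc, h, one_mul]

lemma mulOp_ofContinuous {n : ℕ} {F G : (Fin n → ℝ) → ℂ} (hF : Continuous F)
    (hG : Continuous G) :
    mulOp F hF (ofContinuous G hG) = ofContinuous (fun x => F x * G x) (hF.mul hG) := by
  refine Lp.ext ?_
  filter_upwards [coeFn_mulOp hF (ofContinuous G hG), (memLp_of_continuous hG 2).coeFn_toLp,
    (memLp_of_continuous (F := fun x => F x * G x) (hF.mul hG) 2).coeFn_toLp] with x h1 h2 h3
  rw [h1, ofContinuous, ofContinuous, h2, h3]

/-! ### Algebra of the functions `u_ξ` -/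

/-- With the weight as a parameter, the exponentials (`h = 1`), the multiplier h^{-x} and the dual
system `uFun h⁻¹ (-ξ)` are all instances of `uFun`. -/
lemma uFun_mul {n : ℕ} {h k : Fin n → ℝ} (hh : ∀ j, 0 < h j) (hk : ∀ j, 0 < k j)
    (ξ η : Fin n → ℤ) (x : Fin n → ℝ) :
    uFun h ξ x * uFun k η x = uFun (h * k) (ξ + η) x := by
  have e : ∏ j, (h * k) j ^ x j = (∏ j, h j ^ x j) * ∏ j, k j ^ x j := by
    rw [← Finset.prod_mul_distrib]
    exact Finset.prod_congr rfl fun j _ => Real.mul_rpow (hh j).le (hk j).le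
  have e2 : ∑ j, (((ξ + η) j : ℤ) : ℂ) * (x j : ℂ)
      = ∑ j, (ξ j : ℂ) * (x j : ℂ) + ∑ j, (η j : ℂ) * (x j : ℂ) := by
    rw [← Finset.sum_add_distrib]
    exact Finset.sum_congr rfl fun j _ => by push_cast [Pi.add_apply]; ring
  rw [uFun, uFun, uFun, e, e2, mul_add, Complex.exp_add]
  push_cast
  ring

lemma norm_uFun {n : ℕ} {h : Fin n → ℝ} (ξ : Fin n → ℤ) (x : Fin n → ℝ) :
    ‖uFun h ξ x‖ = ‖uFun h 0 x‖ := by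
  have : (2 * Real.pi * Complex.I * ∑ j, (ξ j : ℂ) * (x j : ℂ))
      = ((2 * Real.pi * ∑ j, (ξ j : ℝ) * x j : ℝ) : ℂ) * Complex.I := by
    push_cast; ring
  rw [uFun, uFun, norm_mul, norm_mul, this, Complex.norm_exp_ofReal_mul_I]
  simp

lemma uFun_one {n : ℕ} (ξ : Fin n → ℤ) (x : Fin n → ℝ) :
    uFun 1 ξ x = Complex.exp (2 * Real.pi * Complex.I * ∑ j, (ξ j : ℂ) * (x j : ℂ)) := by
  simp [uFun]

lemma conj_uFun_one {n : ℕ} (ξ : Fin n → ℤ) (x : Fin n → ℝ) :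
    (starRingEnd ℂ) (uFun 1 ξ x) = uFun 1 (-ξ) x := by
  rw [uFun_one, uFun_one, ← Complex.exp_conj]
  congr 1
  simp [Complex.conj_ofNat]

/-! ### The exponential basis of the cube -/

/-- The projection of `ℝⁿ` onto the torus. -/
def toTorus (n : ℕ) (x : Fin n → ℝ) : UnitAddTorus (Fin n) := fun i => x i

/-- The section of `toTorus` with values in `(0,1]ⁿ`. -/
def fromTorus (n : ℕ) (t : UnitAddTorus (Fin n)) : Fin n → ℝ :=
  (UnitAddTorus.measurableEquivPiIoc (fun _ => 0) t).1

/-- The Haar probability measure on the torus. -/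
abbrev torusMeasure (n : ℕ) : Measure (UnitAddTorus (Fin n)) :=
  Measure.pi fun _ => AddCircle.haarAddCircle

lemma restrict_cube (n : ℕ) :
    (volume : Measure (Fin n → ℝ)).restrict (cube n)
      = volume.restrict {x : Fin n → ℝ | ∀ i, x i ∈ Ioc (0 : ℝ) (0 + 1)} := by
  have := Measure.univ_pi_Ioo_ae_eq_Icc (μ := fun _ : Fin n => (volume : Measure ℝ))
    (f := fun _ => 0) (g := fun _ => 1)
  have h2 := Measure.univ_pi_Ioc_ae_eq_Icc (μ := fun _ : Fin n => (volume : Measure ℝ))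
    (f := fun _ => 0) (g := fun _ => 1)
  refine Measure.restrict_congr_set ((this.trans h2.symm).trans (Filter.EventuallyEq.of_eq ?_))
  ext x
  simp only [zero_add]
  exact mem_univ_pi

lemma measurePreserving_fromTorus (n : ℕ) :
    MeasurePreserving (fromTorus n) (torusMeasure n) (volume.restrict (cube n)) := by
  rw [restrict_cube]
  have hm : MeasurableSet {x : Fin n → ℝ | ∀ i, x i ∈ Ioc (0 : ℝ) (0 + 1)} :=
    MeasurableSet.univ_pi' fun i => measurableSet_Ioc
  exact (measurePreserving_subtype_coe hm).comp
    (UnitAddTorus.measurePreserving_equivPiIoc (fun _ : Fin n => (0 : ℝ)))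

lemma toTorus_fromTorus (n : ℕ) (t : UnitAddTorus (Fin n)) : toTorus n (fromTorus n t) = t :=
  (UnitAddTorus.measurableEquivPiIoc (fun _ => 0)).symm_apply_apply t

lemma fromTorus_toTorus {n : ℕ} {x : Fin n → ℝ} (hx : x ∈ cube n) :
    fromTorus n (toTorus n x) = x := by
  have hx' : ∀ i, x i ∈ Ioc (0 : ℝ) (0 + 1) := fun i =>
    ⟨(hx i (mem_univ i)).1, by rw [zero_add]; exact (hx i (mem_univ i)).2.le⟩
  exact congrArg Subtype.val
    ((UnitAddTorus.measurableEquivPiIoc (fun _ : Fin n => (0 : ℝ))).apply_symm_apply ⟨x, hx'⟩)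

lemma measurable_toTorus (n : ℕ) : Measurable (toTorus n) :=
  measurable_pi_lambda _ fun i => AddCircle.measurable_mk'.comp (measurable_pi_apply i)

lemma measurePreserving_toTorus (n : ℕ) :
    MeasurePreserving (toTorus n) (volume.restrict (cube n)) (torusMeasure n) := by
  refine ⟨measurable_toTorus n, ?_⟩
  rw [← (measurePreserving_fromTorus n).map_eq,
    Measure.map_map (measurable_toTorus n) (measurePreserving_fromTorus n).measurable]
  have : toTorus n ∘ fromTorus n = id := funext (toTorus_fromTorus n)
  rw [this, Measure.map_id]

/-- The unitary map from `L²` of the torus to `L²(Ω)`. -/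
def torusEquiv (n : ℕ) : Lp ℂ 2 (torusMeasure n) ≃ₗᵢ[ℂ] L2 n :=
  LinearIsometryEquiv.ofSurjective
    (Lp.compMeasurePreservingₗᵢ ℂ (toTorus n) (measurePreserving_toTorus n)) fun g => by
      -- The preimage is g ∘ `fromTorus`; the two maps are mutually inverse off a null set.
      refine ⟨Lp.compMeasurePreserving (fromTorus n) (measurePreserving_fromTorus n) g, ?_⟩
      refine Lp.ext ?_
      have h1 := Lp.coeFn_compMeasurePreserving
        (Lp.compMeasurePreserving (fromTorus n) (measurePreserving_fromTorus n) g)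
        (measurePreserving_toTorus n)
      have h2 := (measurePreserving_toTorus n).quasiMeasurePreserving.ae_eq_comp
        (Lp.coeFn_compMeasurePreserving g (measurePreserving_fromTorus n))
      refine h1.trans (h2.trans ?_)
      filter_upwards [ae_restrict_mem (measurableSet_cube n)] with x hx
      simp [fromTorus_toTorus hx]

lemma contDiff_uFun_one {n : ℕ} (ξ : Fin n → ℤ) : ContDiff ℝ ∞ (uFun (1 : Fin n → ℝ) ξ) :=
  contDiff_uFun (fun _ => one_pos) ξ

/-- The Hilbert basis of `L²(Ω)` formed by the exponentials `exp(2πi ξ·x)`. -/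
def expBasis (n : ℕ) : HilbertBasis (Fin n → ℤ) ℂ (L2 n) :=
  .ofRepr ((torusEquiv n).symm.trans (UnitAddTorus.mFourierBasis (d := Fin n)).repr)

lemma expBasis_apply {n : ℕ} (ξ : Fin n → ℤ) :
    expBasis n ξ = ofContinuous (uFun 1 ξ) (contDiff_uFun_one ξ).continuous := by
  have h0 : expBasis n ξ = torusEquiv n (UnitAddTorus.mFourierBasis ξ) := by
    classical
    rw [← HilbertBasis.repr_symm_single, ← HilbertBasis.repr_symm_single]
    rfl
  rw [h0, UnitAddTorus.coe_mFourierBasis]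
  refine Lp.ext ?_
  have h1 := Lp.coeFn_compMeasurePreserving
    (μb := torusMeasure n) (UnitAddTorus.mFourierLp 2 ξ) (measurePreserving_toTorus n)
  have h2 := (measurePreserving_toTorus n).quasiMeasurePreserving.ae_eq_comp
    (UnitAddTorus.coeFn_mFourierLp 2 ξ)
  refine (h1.trans h2).trans ?_
  filter_upwards [(memLp_of_continuous (contDiff_uFun_one ξ).continuous 2).coeFn_toLp] with x hx
  rw [ofContinuous, hx, uFun_one]
  simp only [Function.comp_apply, UnitAddTorus.mFourier, ContinuousMap.coe_mk, toTorus,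
    fourier_coe_apply]
  rw [← Complex.exp_sum, Finset.mul_sum]
  congr 1
  refine Finset.sum_congr rfl fun j _ => ?_
  simp
  ring

/-! ### The biorthogonal expansion -/

section Expansion

variable {n : ℕ} {h : Fin n → ℝ}

lemma inv_weight_pos (hh : ∀ j, 0 < h j) (j : Fin n) : 0 < h⁻¹ j := inv_pos.2 (hh j)

/-- Multiplication by `h^{-x}`. -/
def unweight (h : Fin n → ℝ) (hh : ∀ j, 0 < h j) : L2 n →L[ℂ] L2 n :=
  mulOp (uFun h⁻¹ 0) (contDiff_uFun (inv_weight_pos hh) 0).continuous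

/-- The coefficient of `u_ξ` in the expansion of `f`. -/
def coeffU (h : Fin n → ℝ) (hh : ∀ j, 0 < h j) (ξ : Fin n → ℤ) (f : L2 n) : ℂ :=
  inner ℂ (expBasis n ξ) (unweight h hh f)

lemma mul_inv_weight (hh : ∀ j, 0 < h j) : h * h⁻¹ = 1 := by
  funext j
  exact mul_inv_cancel₀ (hh j).ne'

lemma uFun_mul_inv (hh : ∀ j, 0 < h j) (x : Fin n → ℝ) : uFun h 0 x * uFun h⁻¹ 0 x = 1 := by
  rw [uFun_mul hh (inv_weight_pos hh), mul_inv_weight hh, uFun_one]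
  simp

lemma mulOp_expBasis (hh : ∀ j, 0 < h j) (ξ : Fin n → ℤ) :
    mulOp (uFun h 0) (contDiff_uFun hh 0).continuous (expBasis n ξ) = uL2 h hh ξ := by
  rw [expBasis_apply, mulOp_ofContinuous, uL2]
  congr 1
  funext x
  rw [uFun_mul (k := 1) hh fun _ => one_pos, mul_one, zero_add]

lemma unweight_uL2 (hh : ∀ j, 0 < h j) (ξ : Fin n → ℤ) :
    unweight h hh (uL2 h hh ξ) = expBasis n ξ := by
  rw [← mulOp_expBasis]
  exact mulOp_mulOp_of_mul_eq_one _ _ (fun x => by rw [mul_comm, uFun_mul_inv hh]) _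

/-- The Fourier series of h^{-x} f, multiplied by h^x, which is a bounded operation on L²(Ω). -/
lemma hasSum_coeffU (hh : ∀ j, 0 < h j) (f : L2 n) :
    HasSum (fun ξ => coeffU h hh ξ f • uL2 h hh ξ) f := by
  have h1 := ((expBasis n).hasSum_repr (unweight h hh f)).mapL
    (mulOp (uFun h 0) (contDiff_uFun hh 0).continuous)
  simp only [map_smul, mulOp_expBasis hh, HilbertBasis.repr_apply_apply] at h1
  rwa [unweight, mulOp_mulOp_of_mul_eq_one _ _ (uFun_mul_inv hh)] at h1

lemma coeffU_eq_integral (hh : ∀ j, 0 < h j) (ξ : Fin n → ℤ) (f : L2 n) :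
    coeffU h hh ξ f = ∫ x in cube n, f x * uFun h⁻¹ (-ξ) x := by
  rw [coeffU, L2.inner_def, expBasis_apply]
  refine integral_congr_ae ?_
  filter_upwards [(memLp_of_continuous (contDiff_uFun_one ξ).continuous 2).coeFn_toLp,
    coeFn_mulOp (contDiff_uFun (inv_weight_pos hh) 0).continuous f] with x h1 h2
  rw [RCLike.inner_apply, ofContinuous, h1, unweight, h2, conj_uFun_one, mul_right_comm,
    uFun_mul (k := 1) (inv_weight_pos hh) fun _ => one_pos, mul_one, zero_add, mul_comm]

lemma classicalConjBC_uFun_inv (hh : ∀ j, 0 < h j) (η : Fin n → ℤ) :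
    ClassicalConjBC h (uFun h⁻¹ η) := by
  intro j x hx
  have h0 : (h j : ℂ) ≠ 0 := by exact_mod_cast (hh j).ne'
  obtain ⟨h1, h2⟩ := classicalBC_uFun (inv_weight_pos hh) η j x hx
  rw [← h1, ← h2, Pi.inv_apply, Complex.ofReal_inv]
  exact ⟨(mul_inv_cancel_left₀ h0 _).symm, (mul_inv_cancel_left₀ h0 _).symm⟩

/-- The coefficient is an integral against `uFun h⁻¹ (-ξ)`, which satisfies the conjugate conditions
and is thus admissible in the weak form of (BC). Its exponents are those of u_ξ negated, so their
squares give the same eigenvalue. -/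
lemma coeffU_of_mem_graph (hh : ∀ j, 0 < h j) (ξ : Fin n → ℤ) {f g : L2 n}
    (hfg : (f, g) ∈ (Lh h).graph) :
    coeffU h hh ξ g = (∑ j, uExp h ξ j ^ 2) * coeffU h hh ξ f := by
  have h1 := ((mem_graph_Lh h _).1 hfg).2 _ (contDiff_uFun (inv_weight_pos hh) (-ξ))
    (classicalConjBC_uFun_inv hh (-ξ))
  have h2 : ∑ j, uExp h⁻¹ (-ξ) j ^ 2 = ∑ j, uExp h ξ j ^ 2 := by
    refine Finset.sum_congr rfl fun j _ => ?_
    have : uExp h⁻¹ (-ξ) j = -uExp h ξ j := by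
      simp only [uExp, Pi.inv_apply, Pi.neg_apply, Real.log_inv]
      push_cast
      ring
    rw [this, neg_sq]
  rw [coeffU_eq_integral, coeffU_eq_integral, ← integral_const_mul]
  refine h1.symm.trans (integral_congr_ae (Filter.Eventually.of_forall fun x => ?_))
  simp only [lap_uFun (inv_weight_pos hh), h2]
  ring

/-! ### Expansion in the space of test functions -/

lemma toL2_injective : Function.Injective (toL2 h) := Subtype.val_injective

lemma toL2_uTest (hh : ∀ j, 0 < h j) (ξ : Fin n → ℤ) : toL2 h (uTest h hh ξ) = uL2 h hh ξ := rfl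

lemma toL2_LhTest_mem_graph (f : TestSpace h) :
    (toL2 h f, toL2 h (LhTest h f)) ∈ (Lh h).graph :=
  (Lh h).mem_graph ⟨toL2 h f, toL2_mem_domain h f⟩

lemma LhTest_uTest (hh : ∀ j, 0 < h j) (ξ : Fin n → ℤ) :
    LhTest h (uTest h hh ξ) = (∑ j, uExp h ξ j ^ 2) • uTest h hh ξ := by
  refine toL2_injective ?_
  rw [map_smul, toL2_uTest]
  exact (Lh h).mem_graph_snd_inj (toL2_LhTest_mem_graph _) (uL2_mem_graph hh ξ) rfl

lemma LhTest_pow_uTest (hh : ∀ j, 0 < h j) (ξ : Fin n → ℤ) (k : ℕ) :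
    (LhTest h ^ k) (uTest h hh ξ) = (∑ j, uExp h ξ j ^ 2) ^ k • uTest h hh ξ := by
  induction k with
  | zero => simp
  | succ k ih => rw [pow_succ', Module.End.mul_apply, ih, map_smul, LhTest_uTest, smul_smul, pow_succ]

lemma coeffU_LhTest_pow (hh : ∀ j, 0 < h j) (ξ : Fin n → ℤ) (k : ℕ) (f : TestSpace h) :
    coeffU h hh ξ (toL2 h ((LhTest h ^ k) f))
      = (∑ j, uExp h ξ j ^ 2) ^ k * coeffU h hh ξ (toL2 h f) := by
  induction k with
  | zero => simp
  | succ k ih =>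
    rw [pow_succ', Module.End.mul_apply, coeffU_of_mem_graph hh ξ (toL2_LhTest_mem_graph _), ih,
      pow_succ']
    ring

/-- The expansion of a test function converges in the Fréchet topology. -/
lemma hasSum_coeffU_test (hh : ∀ j, 0 < h j) (f : TestSpace h) :
    HasSum (fun ξ => coeffU h hh ξ (toL2 h f) • uTest h hh ξ) f := by
  have hind : Topology.IsInducing fun (φ : TestSpace h) (j : ℕ) => toL2 h ((LhTest h ^ j) φ) :=
    ⟨rfl⟩
  -- Convergence is tested after each L_h^k, which carries the partial sums to those of the L²
  -- expansion of L_h^k f.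
  refine hind.tendsto_nhds_iff.2 (tendsto_pi_nhds.2 fun k => ?_)
  have h1 := hasSum_coeffU hh (toL2 h ((LhTest h ^ k) f))
  refine Filter.Tendsto.congr (fun F => ?_) h1
  simp only [Function.comp_apply, map_sum, map_smul, LhTest_pow_uTest, toL2_uTest,
    coeffU_LhTest_pow, smul_smul]
  exact Finset.sum_congr rfl fun ξ _ => by rw [mul_comm]

lemma continuous_toL2 : Continuous (toL2 h) := by
  have h1 : Continuous fun (φ : TestSpace h) (j : ℕ) => toL2 h ((LhTest h ^ j) φ) :=
    continuous_induced_dom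
  exact (continuous_apply 0).comp h1

lemma hasSum_coeffU_map (hh : ∀ j, 0 < h j) (A : TestSpace h →L[ℂ] TestSpace h)
    (f : TestSpace h) :
    HasSum (fun ξ => coeffU h hh ξ (toL2 h f) • toL2 h (A (uTest h hh ξ))) (toL2 h (A f)) := by
  have := (hasSum_coeffU_test hh f).map ((toL2 h).comp (A : TestSpace h →ₗ[ℂ] TestSpace h))
    (continuous_toL2.comp A.continuous)
  simpa [Function.comp_def] using this

end Expansion

/-! ### Nuclear operators given by their values on a Hilbert basis -/

/-- Each a_i is at most K^{1/r}, so the factor a_i^{1-r} in a_i = a_i^r · a_i^{1-r} is bounded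
uniformly. -/
lemma tsum_lt_top_of_tsum_rpow_lt_top {ι : Type*} {a : ι → ℝ≥0∞} {r : ℝ} (hr : 0 < r) (hr1 : r ≤ 1)
    (ha : ∑' i, a i ^ r < ⊤) : ∑' i, a i < ⊤ := by
  set K := ∑' i, a i ^ r
  have h1 : ∀ i, a i ≤ a i ^ r * (K ^ (1 / r)) ^ (1 - r) := fun i => by
    have h2 : a i ≤ K ^ (1 / r) := by
      rw [one_div, ENNReal.le_rpow_inv_iff hr]
      exact ENNReal.le_tsum i
    calc a i = a i ^ r * a i ^ (1 - r) := by
          rw [← ENNReal.rpow_add_of_nonneg _ _ hr.le (by linarith), add_sub_cancel, ENNReal.rpow_one]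
      _ ≤ _ := mul_le_mul_right (ENNReal.rpow_le_rpow h2 (by linarith)) _
  refine (ENNReal.tsum_le_tsum h1).trans_lt ?_
  rw [ENNReal.tsum_mul_right]
  exact ENNReal.mul_lt_top ha (ENNReal.rpow_lt_top_of_nonneg (by linarith)
    (ENNReal.rpow_lt_top_of_nonneg (by positivity) ha.ne).ne)

/-- The rank-one terms have norm ‖w_i‖, so the series converges absolutely in operator norm, and
norm limits of finite-rank operators are compact. -/
lemma exists_isCompactOperator_hasSum {ι H : Type*} [NormedAddCommGroup H] [InnerProductSpace ℂ H]
    [CompleteSpace H] (e : HilbertBasis ι ℂ H) {w : ι → H} (hw : Summable fun i => ‖w i‖) :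
    ∃ S : H →L[ℂ] H, IsCompactOperator S ∧
      ∀ x, HasSum (fun i => (inner ℂ (e i) x : ℂ) • w i) (S x) := by
  let R : ι → H →L[ℂ] H := fun i => (innerSL ℂ (e i)).smulRight (w i)
  have hR : Summable R := by
    refine Summable.of_norm (hw.congr fun i => ?_)
    rw [ContinuousLinearMap.norm_smulRight_apply, innerSL_apply_norm, e.orthonormal.1 i, one_mul]
  refine ⟨∑' i, R i, ?_, fun x => ?_⟩
  · refine isCompactOperator_of_tendsto hR.hasSum (Filter.Eventually.of_forall fun F => ?_)
    refine Submodule.sum_mem (compactOperator (RingHom.id ℂ) H H) fun i _ => ?_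
    have h1 : IsCompactOperator (ContinuousLinearMap.toSpanSingleton ℂ (w i)) :=
      isCompactOperator_of_locallyCompactSpace_rng _
    exact h1.comp_clm (innerSL ℂ (e i))
  · simpa [R] using hR.hasSum.mapL (ContinuousLinearMap.apply ℂ H x)

/-! ### Symbols -/

lemma enorm_toL2_le {n : ℕ} {h : Fin n → ℝ} (hh : ∀ j, 0 < h j) {K : ℝ}
    (hK : ∀ x ∈ cube n, ‖uFun h 0 x‖ ≤ K) (A : TestSpace h →L[ℂ] TestSpace h) (ξ : Fin n → ℤ) :
    ‖toL2 h (A (uTest h hh ξ))‖ₑ ≤ ENNReal.ofReal K *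
      eLpNorm (fun x => symbol h hh A x ξ) 2 (volume.restrict (cube n)) := by
  rw [Lp.enorm_def]
  refine eLpNorm_le_mul_eLpNorm_of_ae_le_mul ?_ 2
  filter_upwards [ae_restrict_mem (measurableSet_cube n)] with x hx
  have h1 : (toL2 h (A (uTest h hh ξ)) : L2 n) x = uFun h ξ x * symbol h hh A x ξ := by
    rw [symbol, mul_inv_cancel_left₀ (uFun_ne_zero hh ξ x)]
  rw [h1, norm_mul, norm_uFun]
  exact mul_le_mul_of_nonneg_right (hK x hx) (norm_nonneg _)

end LhModel

end

/-! ### The factorization of A and the Schatten bound -/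

open LhModel
theorem corollary4p4 (n : ℕ) (h : Fin n → ℝ) (hh : ∀ j, 0 < h j) :
    ∃ C : ℝ, 0 < C ∧ ∀ r : ℝ, 0 < r → r ≤ 1 →
      ∀ A : TestSpace h →L[ℂ] TestSpace h,
        ∑' ξ : Fin n → ℤ,
          eLpNorm (fun x => symbol h hh A x ξ) 2 (volume.restrict (cube n)) ^ r < ⊤ →
        ∃ T : L2 n →L[ℂ] L2 n,
          (∀ f : TestSpace h, T (toL2 h f) = toL2 h (A f)) ∧
          MemSchatten r T ∧
          schattenNorm r T ^ r ≤ ENNReal.ofReal C ^ r *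
            ∑' ξ : Fin n → ℤ,
              eLpNorm (fun x => symbol h hh A x ξ) 2 (volume.restrict (cube n)) ^ r := by
  obtain ⟨K₀, hK₀⟩ := (isCompact_Icc (a := (0 : Fin n → ℝ)) (b := 1)).exists_bound_of_continuousOn
    (contDiff_uFun hh 0).continuous.continuousOn
  -- The maximum with 1, like the added 1 in `c`, only secures positivity; both constants depend on
  -- h and n alone, not on r or A.
  set K : ℝ := max K₀ 1
  have hKpos : 0 < K := lt_max_of_lt_right one_pos
  have hK : ∀ x ∈ cube n, ‖uFun h 0 x‖ ≤ K := fun x hx =>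
    (hK₀ x (cube_subset_Icc n hx)).trans (le_max_left _ _)
  set M := unweight h hh
  set c : ℝ := ‖M‖ + 1
  have hc : 0 < c := by positivity
  refine ⟨c * K, by positivity, fun r hr hr1 A hA => ?_⟩
  set Q := ∑' ξ : Fin n → ℤ,
    eLpNorm (fun x => symbol h hh A x ξ) 2 (volume.restrict (cube n)) ^ r
  let w : (Fin n → ℤ) → L2 n := fun ξ => toL2 h (A (uTest h hh ξ))
  have hwle : ∑' ξ, ‖w ξ‖ₑ ^ r ≤ ENNReal.ofReal K ^ r * Q := by
    rw [← ENNReal.tsum_mul_left]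
    refine ENNReal.tsum_le_tsum fun ξ => ?_
    rw [← ENNReal.mul_rpow_of_nonneg _ _ hr.le]
    exact ENNReal.rpow_le_rpow (enorm_toL2_le hh hK A ξ) hr.le
  have hwlt : ∑' ξ, ‖w ξ‖ₑ ^ r < ⊤ := hwle.trans_lt
    (ENNReal.mul_lt_top (ENNReal.rpow_lt_top_of_nonneg hr.le ENNReal.ofReal_ne_top) hA)
  have hsum : Summable fun ξ => ‖w ξ‖ :=
    tsum_enorm_ne_top_iff_summable_norm.1 (tsum_lt_top_of_tsum_rpow_lt_top hr hr1 hwlt).ne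
  obtain ⟨S, hScomp, hS⟩ := exists_isCompactOperator_hasSum (expBasis n) hsum
  have hTA : ∀ f : TestSpace h, (S ∘L M) (toL2 h f) = toL2 h (A f) := fun f =>
    (hS (M (toL2 h f))).unique (hasSum_coeffU_map hh A f)
  have hSe : ∀ ξ, S (expBasis n ξ) = w ξ := fun ξ => by
    -- e_ξ = M u_ξ, and S∘M agrees with A on u_ξ.
    rw [← unweight_uL2 hh ξ]
    exact hTA (uTest h hh ξ)
  have hST : ∀ x, ‖ContinuousLinearMap.adjoint (S ∘L M) x‖
      ≤ c * ‖ContinuousLinearMap.adjoint S x‖ := fun x => by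
    rw [ContinuousLinearMap.adjoint_comp, ContinuousLinearMap.comp_apply]
    refine (ContinuousLinearMap.le_opNorm _ _).trans
      (mul_le_mul_of_nonneg_right ?_ (norm_nonneg _))
    rw [LinearIsometryEquiv.norm_map]
    exact (lt_add_one _).le
  have key := schattenNorm_rpow_le (expBasis n) S (S ∘L M) hc.le hST hr (by linarith)
    (by simpa only [hSe] using hwlt)
  simp only [hSe] at key
  have hbound : schattenNorm r (S ∘L M) ^ r ≤ ENNReal.ofReal (c * K) ^ r * Q := by
    rw [ENNReal.ofReal_mul hc.le, ENNReal.mul_rpow_of_nonneg _ _ hr.le, mul_assoc]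
    exact key.trans (mul_le_mul_right hwle _)
  refine ⟨S ∘L M, hTA, ⟨hScomp.comp_clm M, ?_⟩, hbound⟩
  have hlt := hbound.trans_lt
    (ENNReal.mul_lt_top (ENNReal.rpow_lt_top_of_nonneg hr.le ENNReal.ofReal_ne_top) hA)
  by_contra htop
  rw [not_lt_top_iff.1 htop, ENNReal.top_rpow_of_pos hr] at hlt
  exact lt_irrefl _ hlt
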